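/- All graphs are finite and loopless; parallel edges are allowed. For a nonzero associative ring $M$ with unity and a directed graph $G$, a function $\tau:E(G)\to M$ is an $M$-tension if on every circuit of $G$, traversed in either direction, the sum of $\tau$ over the forward edges equals the sum of $\tau$ over the backward edges. For directed graphs $G,H$, a map $g:E(G)\to E(H)$ is a $TT_M$ mapping if $\tau\circ g$ is an $M$-tension on $G$ for every $M$-tension $\tau$ on $H$. A map between the edge sets of undirected graphs is $TT_M$ if it is $TT_M$ for some orientations of the two graphs. Write $G\preccurlyeq_M H$ if there is a $TT_M$ mapping $E(G)\to E(H)$, and $G\preccurlyeq_h H$ if there is a homomorphism $G\to H$, i.e. a map $V(G)\to V(H)$ that sends each edge $uv$ of $G$ to a pair $f(u)f(v)$ joined by an edge of $H$ (in that direction, in the directed case). Theorem. In each of the two cases, directed and undirected, there are an assignment $F$ of a graph $F(G)$ to every graph $G$, and an assignment of a map $F(f):E(F(G))\to E(F(H))$ to every homomorphism $f:G\to H$, with $F(\mathrm{id}_G)=\mathrm{id}$ and $F(g\circ f)=F(g)\circ F(f)$, such that for every nonzero ring $M$ and all graphs $G,H$: 1. $G\preccurlyeq_h H$ if and only if $F(G)\preccurlyeq_M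 F(H)$; 2. each $F(f)$ is a $TT_M$ mapping, and $f\mapsto F(f)$ is a bijection from the set of homomorphisms $G\to H$ onto the set of all $TT_M$ mappings from $F(G)$ to $F(H)$. In other words, $F$ (which does not depend on $M$) gives, for every nonzero ring $M$, a full and faithful functor from the category of graphs and homomorphisms to the category of graphs and $TT_M$ mappings. -/

import Mathlib

universe u v

/-- A finite loopless directed graph; parallel (and opposite) edges are allowed. -/
structure DiGraph where
  /-- vertices -/
  V : Type u
  /-- edges -/
  E : Type u
  finite_V : Finite V
  finite_E : Finite E
  /-- the vertex that an edge leaves -/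
  src : E → V
  /-- the vertex that an edge enters -/
  tgt : E → V
  loopless : ∀ e, src e ≠ tgt e

namespace DiGraph

/-- A homomorphism: a map of the vertices such that for every edge `uv` of `G` there is an edge
`f(u)f(v)` of `H`. -/
@[ext]
structure Hom (G H : DiGraph.{u}) where
  toFun : G.V → H.V
  map_edge : ∀ e : G.E, ∃ e' : H.E, H.src e' = toFun (G.src e) ∧ H.tgt e' = toFun (G.tgt e)

/-- The identity homomorphism. -/
def Hom.id (G : DiGraph.{u}) : Hom G G where
  toFun := fun x => x
  map_edge := fun e => ⟨e, rfl, rfl⟩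

/-- The composition `g ∘ f` of homomorphisms. -/
def Hom.comp {G H K : DiGraph.{u}} (g : Hom H K) (f : Hom G H) : Hom G K where
  toFun := fun x => g.toFun (f.toFun x)
  map_edge := fun e => by
    obtain ⟨e', h1, h2⟩ := f.map_edge e
    obtain ⟨e'', h3, h4⟩ := g.map_edge e'
    exact ⟨e'', by rw [h3, h1], by rw [h4, h2]⟩

/-- A circuit of length `k + 1` together with a direction of traversal: pairwise distinct vertices
`vert 0, …, vert k` and pairwise distinct edges, where `edge i` joins `vert i` and `vert (i + 1)`
(in either direction, indices modulo `k + 1`). -/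
structure Circuit (G : DiGraph.{u}) where
  k : ℕ
  vert : Fin (k + 1) → G.V
  edge : Fin (k + 1) → G.E
  vert_injective : Function.Injective vert
  edge_injective : Function.Injective edge
  joins : ∀ i, (G.src (edge i) = vert i ∧ G.tgt (edge i) = vert (i + 1)) ∨
    (G.src (edge i) = vert (i + 1) ∧ G.tgt (edge i) = vert i)

open Classical in
/-- The positions of the edges that a circuit traverses forwards. -/
noncomputable def Circuit.pos {G : DiGraph.{u}} (C : G.Circuit) : Finset (Fin (C.k + 1)) :=
  Finset.univ.filter fun i =>
    G.src (C.edge i) = C.vert i ∧ G.tgt (C.edge i) = C.vert (i + 1)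

open Classical in
/-- The positions of the edges that a circuit traverses backwards. -/
noncomputable def Circuit.neg {G : DiGraph.{u}} (C : G.Circuit) : Finset (Fin (C.k + 1)) :=
  Finset.univ.filter fun i =>
    G.src (C.edge i) = C.vert (i + 1) ∧ G.tgt (C.edge i) = C.vert i

/-- `τ` is an `M`-tension: on every circuit the sum over the forward edges equals the sum over the
backward edges. -/
def IsTension {M : Type v} [Ring M] (G : DiGraph.{u}) (τ : G.E → M) : Prop :=
  ∀ C : G.Circuit, ∑ i ∈ C.pos, τ (C.edge i) = ∑ i ∈ C.neg, τ (C.edge i)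

/-- `f` is an `M`-tension-continuous (`TT_M`) mapping. -/
def IsTT (M : Type v) [Ring M] {G H : DiGraph.{u}} (f : G.E → H.E) : Prop :=
  ∀ τ : H.E → M, H.IsTension τ → G.IsTension (τ ∘ f)

/-- `G ≼_h H`: there is a homomorphism from `G` to `H`. -/
def HomLE (G H : DiGraph.{u}) : Prop := Nonempty (Hom G H)

/-- `G ≼_M H`: there is a `TT_M` mapping from `G` to `H`. -/
def TTLE (M : Type v) [Ring M] (G H : DiGraph.{u}) : Prop := ∃ f : G.E → H.E, IsTT M f

end DiGraph

/-- A finite loopless undirected graph; parallel edges are allowed. -/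
structure UGraph where
  /-- vertices -/
  V : Type u
  /-- edges -/
  E : Type u
  finite_V : Finite V
  finite_E : Finite E
  /-- the unordered pair of ends of an edge -/
  ends : E → Sym2 V
  loopless : ∀ e, ¬ (ends e).IsDiag

namespace UGraph

/-- A homomorphism: a map of the vertices that sends adjacent vertices to adjacent vertices. -/
@[ext]
structure Hom (G H : UGraph.{u}) where
  toFun : G.V → H.V
  map_edge : ∀ e : G.E, ∃ e' : H.E, H.ends e' = (G.ends e).map toFun

/-- The identity homomorphism. -/
def Hom.id (G : UGraph.{u}) : Hom G G where
  toFun := fun x => x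
  map_edge := fun e => ⟨e, (congrFun Sym2.map_id (G.ends e)).symm⟩

/-- The composition `g ∘ f` of homomorphisms. -/
def Hom.comp {G H K : UGraph.{u}} (g : Hom H K) (f : Hom G H) : Hom G K where
  toFun := fun x => g.toFun (f.toFun x)
  map_edge := fun e => by
    obtain ⟨e', h1⟩ := f.map_edge e
    obtain ⟨e'', h2⟩ := g.map_edge e'
    exact ⟨e'', by rw [h2, h1, Sym2.map_map]; rfl⟩

/-- An orientation of an undirected graph: a choice of a direction for each of its edges. -/
structure Orientation (G : UGraph.{u}) where
  src : G.E → G.V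
  tgt : G.E → G.V
  ends_eq : ∀ e, s(src e, tgt e) = G.ends e

/-- The directed graph given by an orientation. -/
def Orientation.toDiGraph {G : UGraph.{u}} (o : G.Orientation) : DiGraph.{u} where
  V := G.V
  E := G.E
  finite_V := G.finite_V
  finite_E := G.finite_E
  src := o.src
  tgt := o.tgt
  loopless := fun e h => G.loopless e (by rw [← o.ends_eq e, Sym2.mk_isDiag_iff]; exact h)

/-- A mapping between the edge sets of undirected graphs is `TT_M` if it is `TT_M` for some
orientations of the two graphs. -/
def IsTT (M : Type v) [Ring M] {G H : UGraph.{u}} (f : G.E → H.E) : Prop :=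
  ∃ (oG : G.Orientation) (oH : H.Orientation),
    DiGraph.IsTT M (G := oG.toDiGraph) (H := oH.toDiGraph) f

/-- `G ≼_h H`: there is a homomorphism from `G` to `H`. -/
def HomLE (G H : UGraph.{u}) : Prop := Nonempty (Hom G H)

/-- `G ≼_M H`: there is a `TT_M` mapping from `G` to `H`. -/
def TTLE (M : Type v) [Ring M] (G H : UGraph.{u}) : Prop := ∃ f : G.E → H.E, IsTT M f

end UGraph

/-! The encoding replaces three vertices of a rigid template on 14 vertices by copies of `V(G)`.
Copies 0 and 1 are joined according to the adjacency of `G`; copy 2 is matched with both, so that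
the three copies of a vertex move together. The other 11 template vertices, the core, have only the
inclusion as a homomorphism to the template. Hence homomorphisms of encodings are exactly the maps
induced by homomorphisms of `G`.

It remains to identify `TT_M` mappings of encodings with graph homomorphisms. Pulling back the
tension given by the indicator of a vertex shows that the three sides of a triangle have equal
images or images that form a triangle. Complete graphs on four vertices exclude equal images, for
every nonzero `M`; those on five exclude the remaining non-geometric option, that opposite edges are
identified. So edges at a vertex that share such complete graphs have images with a common point,
which propagates through the link (`TriangleMap.exists_map_eq`). The choice of orientations plays no
role here, so one argument serves both cases.

Conversely, the template has a vertex adjacent to all others, so tensions of an encoding are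
potential differences, and induced maps, which respect the numbering of the template, pull these
back to potential differences. -/

namespace DiGraph

/-! ### Tensions on triangles and complete graphs -/

variable {M : Type v} [Ring M]

/-- The edge `e` joins `x` and `y`, in one direction or the other. -/
def Joins (G : DiGraph.{u}) (e : G.E) (x y : G.V) : Prop :=
  (G.src e = x ∧ G.tgt e = y) ∨ (G.src e = y ∧ G.tgt e = x)

lemma Joins.symm {G : DiGraph.{u}} {e : G.E} {x y : G.V} (h : G.Joins e x y) : G.Joins e y x :=
  Or.symm h

open Classical in
/-- The sign with which the edge `e` is traversed by a walk that enters it at `x`. -/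
noncomputable def sign (G : DiGraph.{u}) (e : G.E) (x : G.V) : ℤ := if G.src e = x then 1 else -1

lemma sign_eq_or (G : DiGraph.{u}) (e : G.E) (x : G.V) : G.sign e x = 1 ∨ G.sign e x = -1 := by
  unfold sign; split_ifs <;> simp

lemma Joins.sign_swap {G : DiGraph.{u}} {e : G.E} {x y : G.V} (h : G.Joins e x y) :
    G.sign e y = -G.sign e x := by
  have hl := G.loopless e
  unfold sign
  rcases h with ⟨h1, h2⟩ | ⟨h1, h2⟩
  · rw [if_pos h1, if_neg (by rw [← h2]; exact hl)]
  · rw [if_pos h1, if_neg (by rw [← h2]; exact hl)]; rfl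

/-- Without loops each edge is traversed in exactly one direction, so `pos` and `neg` partition the
positions. -/
lemma Circuit.sum_pos_sub_sum_neg {G : DiGraph.{u}} (C : G.Circuit) (τ : G.E → M) :
    ∑ i ∈ C.pos, τ (C.edge i) - ∑ i ∈ C.neg, τ (C.edge i) =
      ∑ i, G.sign (C.edge i) (C.vert i) • τ (C.edge i) := by
  classical
  unfold Circuit.pos Circuit.neg
  rw [Finset.sum_filter, Finset.sum_filter, ← Finset.sum_sub_distrib]
  refine Finset.sum_congr rfl fun i _ => ?_
  have hl := G.loopless (C.edge i)
  unfold sign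
  rcases C.joins i with ⟨h1, h2⟩ | ⟨h1, h2⟩
  · rw [if_pos ⟨h1, h2⟩, if_neg (fun h => hl (by rw [h1, h.2])), if_pos h1]; simp
  · rw [if_neg (fun h => hl (by rw [h.1, h2])), if_pos ⟨h1, h2⟩,
      if_neg (fun h => hl (by rw [h, h2]))]; simp

lemma isTension_iff_sum_sign {G : DiGraph.{u}} {τ : G.E → M} :
    G.IsTension τ ↔
      ∀ C : G.Circuit, ∑ i, G.sign (C.edge i) (C.vert i) • τ (C.edge i) = 0 := by
  refine forall_congr' fun C => ?_
  rw [← C.sum_pos_sub_sum_neg, sub_eq_zero]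

lemma Joins.sign_smul_potential {G : DiGraph.{u}} {e : G.E} {x y : G.V} (h : G.Joins e x y)
    (p : G.V → M) : G.sign e x • (p (G.tgt e) - p (G.src e)) = p y - p x := by
  have hl := G.loopless e
  unfold sign
  rcases h with ⟨h1, h2⟩ | ⟨h1, h2⟩
  · rw [if_pos h1, h1, h2]; simp
  · rw [if_neg (by rw [← h2]; exact hl), h1, h2]; simp

/-- Potential differences are tensions. -/
lemma isTension_potential (G : DiGraph.{u}) (p : G.V → M) :
    G.IsTension fun e => p (G.tgt e) - p (G.src e) := by
  rw [isTension_iff_sum_sign]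
  intro C
  have : ∀ i, G.sign (C.edge i) (C.vert i) • (p (G.tgt (C.edge i)) - p (G.src (C.edge i))) =
      p (C.vert (i + 1)) - p (C.vert i) := fun i => Joins.sign_smul_potential (C.joins i) p
  simp only [this, Finset.sum_sub_distrib]
  rw [sub_eq_zero]
  exact Equiv.sum_comp (Equiv.addRight (1 : Fin (C.k + 1))) fun i => p (C.vert i)

/-- A tension sums to zero around a triangle. -/
lemma IsTension.triangle {G : DiGraph.{u}} {τ : G.E → M} (hτ : G.IsTension τ) {x y z : G.V}
    {a b c : G.E} (hxy : x ≠ y) (hyz : y ≠ z) (hxz : x ≠ z)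
    (ha : G.Joins a x y) (hb : G.Joins b y z) (hc : G.Joins c x z) :
    G.sign a x • τ a + G.sign b y • τ b = G.sign c x • τ c := by
  have key := isTension_iff_sum_sign.1 hτ
    { k := 2
      vert := ![x, y, z]
      edge := ![a, b, c]
      vert_injective := by
        intro i j; fin_cases i <;> fin_cases j <;> simp [hxy, hyz, hxz, hxy.symm, hyz.symm, hxz.symm]
      edge_injective := by
        have hab : a ≠ b := by rintro rfl; unfold Joins at *; grind
        have hbc : b ≠ c := by rintro rfl; unfold Joins at *; grind
        have hac : a ≠ c := by rintro rfl; unfold Joins at *; grind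
        intro i j; fin_cases i <;> fin_cases j <;> simp [hab, hbc, hac, hab.symm, hbc.symm, hac.symm]
      joins := by
        intro i; fin_cases i
        · exact ha
        · exact hb
        · exact hc.symm }
  rw [Fin.sum_univ_three] at key
  simp only [Matrix.cons_val] at key
  rw [hc.sign_swap, neg_smul, ← sub_eq_add_neg, sub_eq_zero] at key
  exact key

lemma eq_zero_of_intCast_eq_zero [Nontrivial M] {n : ℤ} (h : (n : M) = 0) : n ≠ 1 ∧ n ≠ -1 := by
  constructor <;> rintro rfl <;> simp at h

variable {G H : DiGraph.{u}} {f : G.E → H.E}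

/-- A vertex on the image of one edge of a triangle lies on the image of another one. -/
lemma IsTT.mem_triangle [Nontrivial M] (hf : IsTT M f) {x y z : G.V} {a b c : G.E}
    (hxy : x ≠ y) (hyz : y ≠ z) (hxz : x ≠ z)
    (ha : G.Joins a x y) (hb : G.Joins b y z) (hc : G.Joins c x z) {w : H.V}
    (hw : H.src (f a) = w ∨ H.tgt (f a) = w) :
    (H.src (f b) = w ∨ H.tgt (f b) = w) ∨ (H.src (f c) = w ∨ H.tgt (f c) = w) := by
  classical
  by_contra! hcon
  obtain ⟨⟨hb1, hb2⟩, hc1, hc2⟩ := hcon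
  -- The indicator of `w` as a potential gives a tension that is `±1` on `f a`, which has `w` as
  -- exactly one end, and `0` on `f b` and `f c`.
  have key := (hf _ (H.isTension_potential fun v => if v = w then (1 : M) else 0)).triangle
    hxy hyz hxz ha hb hc
  have hl := H.loopless (f a)
  simp only [Function.comp_apply, if_neg hb1, if_neg hb2, if_neg hc1, if_neg hc2, sub_self,
    smul_zero, add_zero] at key
  rcases hw with rfl | rfl <;> rcases G.sign_eq_or a x with hs | hs <;>
    simp [hs, hl, hl.symm] at key

/-- A `TT_M` mapping is not constant on a complete graph with four vertices. -/
lemma IsTT.not_const [Nontrivial M] (hf : IsTT M f) {x : Fin 4 → G.V}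
    (hx : Function.Injective x) {a b c d g h : G.E}
    (ha : G.Joins a (x 0) (x 1)) (hb : G.Joins b (x 1) (x 2)) (hc : G.Joins c (x 0) (x 2))
    (hd : G.Joins d (x 0) (x 3)) (hg : G.Joins g (x 1) (x 3)) (hh : G.Joins h (x 2) (x 3))
    {e : H.E} : ¬ (f a = e ∧ f b = e ∧ f c = e ∧ f d = e ∧ f g = e ∧ f h = e) := by
  classical
  rintro ⟨e1, e2, e3, e4, e5, e6⟩
  have hne : ∀ i j, i ≠ j → x i ≠ x j := fun i j h => hx.ne h
  have hT := hf _ (H.isTension_potential fun v => if v = H.tgt e then (1 : M) else 0)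
  have hl := H.loopless e
  have k1 := hT.triangle (hne 0 1 (by decide)) (hne 1 2 (by decide)) (hne 0 2 (by decide)) ha hb hc
  have k2 := hT.triangle (hne 0 1 (by decide)) (hne 1 3 (by decide)) (hne 0 3 (by decide)) ha hg hd
  have k3 := hT.triangle (hne 1 2 (by decide)) (hne 2 3 (by decide)) (hne 1 3 (by decide)) hb hh hg
  have k4 := hT.triangle (hne 0 2 (by decide)) (hne 2 3 (by decide)) (hne 0 3 (by decide)) hc hh hd
  simp only [Function.comp_apply, e1, e2, e3, e4, e5, e6, if_true, if_neg hl, sub_zero,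
    zsmul_one, ← Int.cast_add] at k1 k2 k3 k4
  rw [← sub_eq_zero, ← Int.cast_sub] at k1 k2 k3 k4
  -- Each relation says that an integer among `±1, ±3` vanishes in `M`. As `1 ≠ 0`, it is `±3`, so
  -- the triangle is cyclically oriented; the four triangles cannot all be. One triangle would not
  -- suffice when `3 = 0` in `M`.
  have k1 := eq_zero_of_intCast_eq_zero k1
  have k2 := eq_zero_of_intCast_eq_zero k2
  have k3 := eq_zero_of_intCast_eq_zero k3
  have k4 := eq_zero_of_intCast_eq_zero k4
  have s1 := G.sign_eq_or a (x 0)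
  have s2 := G.sign_eq_or b (x 1)
  have s3 := G.sign_eq_or c (x 0)
  have s4 := G.sign_eq_or d (x 0)
  have s5 := G.sign_eq_or g (x 1)
  have s6 := G.sign_eq_or h (x 2)
  omega

end DiGraph

/-! ### Triangles of unordered pairs -/

/-- Three unordered pairs that are the sides of a triangle. -/
def IsTriangle {W : Type*} (A B C : Sym2 W) : Prop :=
  ∃ x y z, x ≠ y ∧ y ≠ z ∧ x ≠ z ∧ A = s(x, y) ∧ B = s(y, z) ∧ C = s(x, z)

section Triangles

variable {W : Type*} {A B C D : Sym2 W}

lemma IsTriangle.rotate (h : IsTriangle A B C) : IsTriangle B C A := by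
  obtain ⟨x, y, z, h1, h2, h3, rfl, rfl, rfl⟩ := h
  exact ⟨y, z, x, h2, h3.symm, h1.symm, rfl, Sym2.eq_swap, Sym2.eq_swap⟩

lemma IsTriangle.swap (h : IsTriangle A B C) : IsTriangle A C B := by
  obtain ⟨x, y, z, h1, h2, h3, rfl, rfl, rfl⟩ := h
  exact ⟨y, x, z, h1.symm, h3, h2, Sym2.eq_swap, rfl, rfl⟩

lemma IsTriangle.ne (h : IsTriangle A B C) : A ≠ B := by
  obtain ⟨x, y, z, h1, h2, h3, rfl, rfl, rfl⟩ := h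
  rw [Ne, Sym2.eq_iff]; grind

lemma IsTriangle.eq_third (h : IsTriangle A B C) (h' : IsTriangle A B D) : C = D := by
  obtain ⟨x, y, z, h1, h2, h3, rfl, rfl, rfl⟩ := h
  obtain ⟨x', y', z', h1', h2', h3', e1, e2, rfl⟩ := h'
  rw [Sym2.eq_iff] at e1 e2 ⊢; grind

lemma IsTriangle.exists_mem (h : IsTriangle A B C) : ∃ x, x ∈ A ∧ x ∈ B := by
  obtain ⟨x, y, z, h1, h2, h3, rfl, rfl, rfl⟩ := h
  exact ⟨y, by simp, by simp⟩

/-- If no point lies on exactly one of three pairs, these are equal or form a triangle. -/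
lemma eq_or_isTriangle (hA : ¬ A.IsDiag) (hB : ¬ B.IsDiag) (hC : ¬ C.IsDiag)
    (h1 : ∀ x ∈ A, x ∈ B ∨ x ∈ C) (h2 : ∀ x ∈ B, x ∈ A ∨ x ∈ C) (h3 : ∀ x ∈ C, x ∈ A ∨ x ∈ B) :
    (A = B ∧ A = C) ∨ IsTriangle A B C := by
  induction A with | _ a a'
  induction B with | _ b b'
  induction C with | _ c c'
  simp only [Sym2.mem_iff, Sym2.mk_isDiag_iff] at *
  have a1 := h1 a (.inl rfl)
  have a2 := h1 a' (.inr rfl)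
  have b1 := h2 b (.inl rfl)
  have b2 := h2 b' (.inr rfl)
  have c1 := h3 c (.inl rfl)
  have c2 := h3 c' (.inr rfl)
  clear h1 h2 h3
  by_cases hAB : s(a, a') = s(b, b')
  · left
    rw [Sym2.eq_iff] at *
    refine ⟨hAB, ?_⟩
    rw [Sym2.eq_iff]
    grind
  · right
    rw [Sym2.eq_iff] at hAB
    -- The first two pairs meet, since otherwise the third would contain all four of their points.
    have : ∃ x y z, s(a, a') = s(x, y) ∧ s(b, b') = s(y, z) ∧ x ≠ z := by
      by_cases h : a' = b
      · exact ⟨a, a', b', rfl, by rw [h], by grind⟩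
      by_cases h' : a' = b'
      · exact ⟨a, a', b, rfl, by rw [h', Sym2.eq_swap], by grind⟩
      by_cases h'' : a = b
      · exact ⟨a', a, b', Sym2.eq_swap, by rw [h''], by grind⟩
      by_cases h3 : a = b'
      · exact ⟨a', a, b, Sym2.eq_swap, by rw [h3, Sym2.eq_swap], by grind⟩
      · grind
    obtain ⟨x, y, z, e1, e2, e3⟩ := this
    refine ⟨x, y, z, ?_, ?_, e3, e1, e2, ?_⟩ <;> simp only [Sym2.eq_iff, ne_eq] at * <;> grind

end Triangles

/-! ### Triangle maps that come from maps of the vertices -/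

namespace SimpleGraph

variable {V W : Type*}

/-- Four pairwise adjacent vertices. -/
structure IsK4 (G : SimpleGraph V) (a b c d : V) : Prop where
  ab : G.Adj a b
  ac : G.Adj a c
  ad : G.Adj a d
  bc : G.Adj b c
  bd : G.Adj b d
  cd : G.Adj c d

/-- Five pairwise adjacent vertices. -/
structure IsK5 (G : SimpleGraph V) (a b c d e : V) : Prop extends G.IsK4 a b c d where
  ae : G.Adj a e
  be : G.Adj b e
  ce : G.Adj c e
  de : G.Adj d e

/-- A map of pairs under which no point lies on the image of exactly one side of a triangle of `G`,
and which is not constant on the sides of four pairwise adjacent vertices. -/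
structure TriangleMap (G : SimpleGraph V) (φ : Sym2 V → Sym2 W) : Prop where
  not_isDiag : ∀ {a b}, G.Adj a b → ¬ (φ s(a, b)).IsDiag
  mem : ∀ {a b c}, G.Adj a b → G.Adj b c → G.Adj a c → ∀ x ∈ φ s(a, b), x ∈ φ s(b, c) ∨ x ∈ φ s(a, c)
  not_const : ∀ {a b c d}, G.IsK4 a b c d → ¬ (φ s(b, c) = φ s(a, b) ∧
    φ s(a, c) = φ s(a, b) ∧ φ s(a, d) = φ s(a, b) ∧ φ s(b, d) = φ s(a, b) ∧ φ s(c, d) = φ s(a, b))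

namespace TriangleMap

variable {G : SimpleGraph V} {φ : Sym2 V → Sym2 W} {a b c d e : V}

lemma eq_or_isTriangle (hφ : G.TriangleMap φ) (hab : G.Adj a b) (hbc : G.Adj b c)
    (hac : G.Adj a c) : (φ s(a, b) = φ s(b, c) ∧ φ s(a, b) = φ s(a, c)) ∨
      IsTriangle (φ s(a, b)) (φ s(b, c)) (φ s(a, c)) := by
  refine _root_.eq_or_isTriangle (hφ.not_isDiag hab) (hφ.not_isDiag hbc) (hφ.not_isDiag hac)
    (hφ.mem hab hbc hac) (fun x hx => ?_) (fun x hx => ?_)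
  · have := hφ.mem hbc hac.symm hab.symm x hx
    rw [Sym2.eq_swap (a := c), Sym2.eq_swap (a := b) (b := a)] at this
    exact this.symm
  · have := hφ.mem hac hbc.symm hab x hx
    rw [Sym2.eq_swap (a := c)] at this
    exact this.symm

/-- Suppose `abc` has constant image. If the other three triangles are constant too, `not_const`
fails; mixed cases contradict that sides of a triangle differ. If none is constant, uniqueness of
the third side gives `ad` and `cd` the same image, although they are sides of one triangle. -/
lemma isTriangle (hφ : G.TriangleMap φ) (h : G.IsK4 a b c d) :
    IsTriangle (φ s(a, b)) (φ s(b, c)) (φ s(a, c)) := by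
  refine (hφ.eq_or_isTriangle h.ab h.bc h.ac).resolve_left fun ⟨h1, h2⟩ => ?_
  have t1 := hφ.eq_or_isTriangle h.ab h.bd h.ad
  have t2 := hφ.eq_or_isTriangle h.bc h.cd h.bd
  have t3 := hφ.eq_or_isTriangle h.ac h.cd h.ad
  have hn := hφ.not_const h
  rw [← h1] at t2
  rw [← h2] at t3
  rcases t1 with t1 | t1 <;> rcases t2 with t2 | t2 <;> rcases t3 with t3 | t3
  · grind
  · exact t3.swap.ne t1.2
  · exact t2.swap.ne t1.1
  · exact t3.swap.ne t1.2
  · exact t1.ne t2.2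
  · exact t1.ne t2.2
  · exact t1.swap.ne t3.2
  · exact t3.rotate.ne (t1.eq_third t2.swap).symm

/-- The six pairs of four pairwise adjacent vertices are either mapped as by a map of the vertices,
or opposite pairs are identified. -/
lemma isK4_cases (hφ : G.TriangleMap φ) (h : G.IsK4 a b c d) :
    (∃ x y z t, x ≠ y ∧ y ≠ z ∧ x ≠ z ∧ t ≠ x ∧ t ≠ y ∧ t ≠ z ∧ φ s(a, b) = s(x, y) ∧
      φ s(b, c) = s(y, z) ∧ φ s(a, c) = s(x, z) ∧ φ s(a, d) = s(x, t)) ∨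
    φ s(a, d) = φ s(b, c) := by
  obtain ⟨x, y, z, hxy, hyz, hxz, e1, e2, e3⟩ := hφ.isTriangle h
  have t1 := hφ.isTriangle (a := a) (b := b) (c := d) (d := c)
    ⟨h.ab, h.ad, h.ac, h.bd, h.bc, h.cd.symm⟩
  have t2 := hφ.isTriangle (a := b) (b := c) (c := d) (d := a)
    ⟨h.bc, h.bd, h.ab.symm, h.cd, h.ac.symm, h.ad.symm⟩
  have t3 := hφ.isTriangle (a := a) (b := c) (c := d) (d := b)
    ⟨h.ac, h.ad, h.ab, h.cd, h.bc.symm, h.bd.symm⟩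
  rw [e1] at t1
  rw [e2] at t2
  rw [e3] at t3
  obtain ⟨x1, y1, z1, n1, n2, n3, f1, f2, f3⟩ := t1
  obtain ⟨x2, y2, z2, m1, m2, m3, g1, g2, g3⟩ := t2
  obtain ⟨x3, y3, z3, k1, k2, k3, i1, i2, i3⟩ := t3
  rw [e1, e2, e3]
  -- Here `x` is common to the images of `ab` and `ac`, and `x1` to those of `ab` and `ad`. If they
  -- differ, the images fold onto a single triangle.
  by_cases hx : x1 = x
  · subst hx
    left
    refine ⟨x1, y, z, z1, hxy, hyz, hxz, n3.symm, ?_, ?_, rfl, rfl, rfl, f3⟩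
    all_goals
      rw [f3] at i3; rw [f2] at g3; rw [g2] at i2
      simp only [Sym2.eq_iff] at *
      grind
  · right
    rw [f3]
    rw [f3] at i3; rw [f2] at g3; rw [g2] at i2
    simp only [Sym2.eq_iff] at *
    grind

/-- The fifth vertex `e` excludes that `ad` and `bc` have the same image. In `abce`, the image of
`ae` is disjoint from that of `bc` or equal to it, whereas the images of `ad` and `ae` are distinct
and meet. -/
lemma mem_of_isK5 (hφ : G.TriangleMap φ) (h : G.IsK5 a b c d e) {x : W}
    (hb : x ∈ φ s(a, b)) (hc : x ∈ φ s(a, c)) : x ∈ φ s(a, d) := by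
  rcases hφ.isK4_cases h.toIsK4 with ⟨x', y, z, t, h1, h2, h3, h4, h5, h6, e1, e2, e3, e4⟩ | hopp
  · rw [e1, Sym2.mem_iff] at hb
    rw [e3, Sym2.mem_iff] at hc
    rw [e4, Sym2.mem_iff]
    grind
  · exfalso
    have t1 := hφ.isTriangle (a := a) (b := d) (c := e) (d := b)
      ⟨h.ad, h.ae, h.ab, h.de, h.bd.symm, h.be.symm⟩
    rcases hφ.isK4_cases (a := a) (b := b) (c := c) (d := e)
      ⟨h.ab, h.ac, h.ae, h.bc, h.be, h.ce⟩ with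
      ⟨x', y, z, t, h1, h2, h3, h4, h5, h6, e1, e2, e3, e4⟩ | hopp'
    · obtain ⟨w, hw1, hw2⟩ := t1.swap.exists_mem
      rw [hopp, e2, Sym2.mem_iff] at hw1
      rw [e4, Sym2.mem_iff] at hw2
      grind
    · exact t1.swap.ne (hopp.trans hopp'.symm)

end TriangleMap

/-- The vertices that are reached from the edge `pq` in the link of `u` by repeatedly completing an
edge to a triangle, inside complete graphs with five vertices. -/
inductive LinkReach (G : SimpleGraph V) (u p q : V) : V → Prop
  | left : LinkReach G u p q p
  | right : LinkReach G u p q q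
  | step {a b c d : V} : LinkReach G u p q a → LinkReach G u p q b → G.IsK5 u a b c d →
      LinkReach G u p q c

/-- A graph in which every edge lies in a complete graph with four vertices and in which all links
are connected through complete graphs with five vertices. -/
structure Nice (G : SimpleGraph V) : Prop where
  exists_isK4 : ∀ {a b}, G.Adj a b → ∃ c d, G.IsK4 a b c d
  exists_linkReach : ∀ u, ∃ p q r, G.IsK4 u p q r ∧ ∀ a, G.Adj u a → G.LinkReach u p q a

/-- On a nice graph, a triangle map is induced by a map of the vertices. -/
lemma TriangleMap.exists_map_eq {G : SimpleGraph V} {φ : Sym2 V → Sym2 W} (hG : G.Nice)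
    (hφ : G.TriangleMap φ) : ∃ g : V → W, ∀ a b, G.Adj a b → φ s(a, b) = s(g a, g b) := by
  -- The image of `u` will be the point common to the images of all edges at `u`.
  have key : ∀ u, ∃ x, ∀ a, G.Adj u a → x ∈ φ s(u, a) := by
    intro u
    obtain ⟨p, q, r, hK, hr⟩ := hG.exists_linkReach u
    obtain ⟨x, y, z, -, -, -, e1, e2, e3⟩ := hφ.isTriangle hK
    refine ⟨x, fun a ha => ?_⟩
    induction hr a ha with
    | left => rw [e1]; simp
    | right => rw [e3]; simp
    | step _ _ hK5 h1 h2 => exact hφ.mem_of_isK5 hK5 (h1 hK5.ab) (h2 hK5.ac)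
  choose g hg using key
  refine ⟨g, fun a b hab => ?_⟩
  obtain ⟨c, d, hK⟩ := hG.exists_isK4 hab
  obtain ⟨x, y, z, h1, h2, h3, e1, e2, e3⟩ := hφ.isTriangle hK
  -- Two sides of a triangle meet in one point only, so the chosen points of `a` and `b` are the
  -- corners `x` and `y`.
  have a1 := hg a b hab
  have a2 := hg a c hK.ac
  have b1 := hg b a hab.symm
  have b2 := hg b c hK.bc
  rw [Sym2.eq_swap (a := b)] at b1
  rw [e1, Sym2.mem_iff] at a1 b1
  rw [e3, Sym2.mem_iff] at a2
  rw [e2, Sym2.mem_iff] at b2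
  rw [e1, Sym2.eq_iff]
  grind

end SimpleGraph

/-! ### The rigid template, verified by a search -/

/-- The `c`-th binary digit of `m`, written so that the kernel evaluates it fast. -/
def bit (m c : ℕ) : Bool := Nat.beq (Nat.land (Nat.shiftRight m c) 1) 1

lemma bit_eq_testBit (m c : ℕ) : bit m c = m.testBit c := by
  have : bit m c = Nat.beq ((m >>> c) &&& 1) 1 := rfl
  rw [this, Nat.testBit, Nat.and_comm, Nat.one_and_eq_mod_two]
  rcases Nat.mod_two_eq_zero_or_one (m >>> c) with h | h <;> rw [h] <;> rfl

lemma bit_land (m r c : ℕ) : bit (Nat.land m r) c = (bit m c && bit r c) := by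
  simp only [bit_eq_testBit]
  exact Nat.testBit_and m r c

namespace Template

/-- The rows of the adjacency matrix of the template graph on `14` vertices, in binary. -/
def rows : List ℕ :=
  [16382, 1597, 4603, 87, 8943, 14231, 2461, 2421, 16101, 11571, 6947, 14273, 11557, 6961]

/-- The `i`-th row of the adjacency matrix. -/
def row (i : ℕ) : ℕ := rows.getD i 0

/-- The candidate sets that are left when a vertex with row `a` is sent to a vertex with row `r`. -/
def prune (a r : ℕ) : ℕ → List ℕ → List ℕ
  | _, [] => []
  | j, m :: ms => cond (bit a j) (Nat.land m r) m :: prune a r (Nat.succ j) ms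

/-- `P` holds for all elements of the set `m` that are at least `c`, with their rows. -/
def allCand (P : ℕ → ℕ → Bool) (m : ℕ) : ℕ → List ℕ → Bool
  | _, [] => true
  | c, r :: rs => cond (bit m c) (cond (P c r) (allCand P m (Nat.succ c) rs) false)
      (allCand P m (Nat.succ c) rs)

/-- Search for a partial homomorphism on the vertices from `k` on, with given candidate sets. -/
def noHom : List ℕ → ℕ → List ℕ → Bool
  -- A complete assignment is a homomorphism and refutes the claim. A branch closes only at an empty
  -- candidate set, where `allCand` holds vacuously.
  | [], _, _ => false
  | _, _, [] => false
  | a :: as, k, m :: ms =>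
    allCand (fun _ r => noHom as (Nat.succ k) (prune a r (Nat.succ k) ms)) m 0 rows

/-- Check that the identity is the only partial homomorphism on the vertices from `k` on. -/
def uniqueHom : List ℕ → ℕ → List ℕ → Bool
  | _, _, [] => true
  | [], _, _ => false
  | a :: as, k, m :: ms =>
    cond (allCand (fun c r => cond (Nat.beq c k) true
      (noHom as (Nat.succ k) (prune a r (Nat.succ k) ms))) m 0 rows)
     (uniqueHom as (Nat.succ k) (prune a a (Nat.succ k) ms)) false

/-- The map `f` respects the candidate sets `ms` and the adjacency of the vertices from `k` on. -/
structure Fits (f : ℕ → ℕ) (k : ℕ) (ms : List ℕ) : Prop where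
  lt : ∀ i < ms.length, f (k + i) < 14
  mem : ∀ i < ms.length, bit (ms.getD i 0) (f (k + i)) = true
  adj : ∀ i j, i < j → j < ms.length → bit (row (k + i)) (k + j) = true →
    bit (row (f (k + i))) (f (k + j)) = true

lemma length_prune (a r j : ℕ) (ms : List ℕ) : (prune a r j ms).length = ms.length := by
  induction ms generalizing j with
  | nil => rfl
  | cons m ms ih => simp [prune, ih]

lemma getD_prune (a r j : ℕ) (ms : List ℕ) (i : ℕ) (hi : i < ms.length) :
    (prune a r j ms).getD i 0 = cond (bit a (j + i)) (Nat.land (ms.getD i 0) r) (ms.getD i 0) := by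
  induction ms generalizing i j with
  | nil => simp at hi
  | cons m ms ih =>
    cases i with
    | zero => rfl
    | succ i =>
      simp only [prune, List.getD_cons_succ]
      rw [ih _ _ (by simpa using hi), Nat.succ_add, Nat.add_succ]

lemma allCand_spec {P : ℕ → ℕ → Bool} {m c : ℕ} {rs : List ℕ} (h : allCand P m c rs = true)
    (i : ℕ) (hi : i < rs.length) (hb : bit m (c + i) = true) : P (c + i) (rs.getD i 0) = true := by
  induction rs generalizing c i with
  | nil => simp at hi
  | cons r rs ih =>
    rw [allCand] at h
    have hrest : allCand P m (Nat.succ c) rs = true := by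
      cases hc : bit m c <;> cases hp : P c r <;> simp_all
    cases i with
    | zero =>
      rw [Nat.add_zero] at hb ⊢
      rw [hb] at h
      cases hp : P c r <;> simp_all
    | succ i =>
      have := ih hrest i (by simpa using hi) (by rwa [Nat.succ_add])
      rwa [Nat.succ_add] at this

/-- Pruning loses nothing: if a later vertex is adjacent to `k`, its image already lies in the row
of `f k`. -/
lemma Fits.tail {f : ℕ → ℕ} {k m : ℕ} {ms : List ℕ} (h : Fits f k (m :: ms)) :
    Fits f (k + 1) (prune (row k) (row (f k)) (k + 1) ms) where
  lt i hi := by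
    rw [length_prune] at hi
    have := h.lt (i + 1) (by simpa using hi)
    rwa [show k + 1 + i = k + (i + 1) by omega]
  mem i hi := by
    rw [length_prune] at hi
    rw [getD_prune _ _ _ _ _ hi]
    have h1 := h.mem (i + 1) (by simpa using hi)
    have h2 := h.adj 0 (i + 1) (by omega) (by simpa using hi)
    rw [List.getD_cons_succ] at h1
    rw [show k + 1 + i = k + (i + 1) by omega]
    cases hb : bit (row k) (k + (i + 1)) with
    | false => exact h1
    | true => rw [cond_true, bit_land, h1]; exact h2 hb
  adj i j hij hj hb := by
    rw [length_prune] at hj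
    have := h.adj (i + 1) (j + 1) (by omega) (by simpa using hj)
    rw [show k + 1 + i = k + (i + 1) by omega, show k + 1 + j = k + (j + 1) by omega] at *
    exact this hb

lemma row_of_drop {k a : ℕ} {as : List ℕ} (h : rows.drop k = a :: as) :
    row k = a ∧ rows.drop (k + 1) = as := by
  constructor
  · have := List.head?_drop (l := rows) (i := k)
    rw [h] at this
    simp [row, List.getD_eq_getElem?_getD, ← this]
  · rw [← List.tail_drop, h]; rfl

lemma noHom_spec {as : List ℕ} {k : ℕ} {ms : List ℕ} (has : rows.drop k = as)
    (h : noHom as k ms = true) (f : ℕ → ℕ) : ¬ Fits f k ms := by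
  induction as generalizing k ms with
  | nil => simp [noHom] at h
  | cons a as ih =>
    cases ms with
    | nil => simp [noHom] at h
    | cons m ms =>
      intro hf
      obtain ⟨hrow, hdrop⟩ := row_of_drop has
      have h0 := hf.lt 0 (by simp)
      have h1 := hf.mem 0 (by simp)
      have := allCand_spec h (f k) h0 (by simpa using h1)
      rw [← hrow] at this
      exact ih hdrop this hf.tail

/-- A value of `f k` other than `k` is refuted by `noHom_spec`; so `f k = k`, and the candidates are
pruned by the row of `k` itself. -/
lemma uniqueHom_spec {as : List ℕ} {k : ℕ} {ms : List ℕ} (has : rows.drop k = as)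
    (h : uniqueHom as k ms = true) {f : ℕ → ℕ} (hf : Fits f k ms) :
    ∀ i < ms.length, f (k + i) = k + i := by
  induction as generalizing k ms with
  | nil => cases ms with
    | nil => simp
    | cons m ms => simp [uniqueHom] at h
  | cons a as ih =>
    cases ms with
    | nil => simp
    | cons m ms =>
      obtain ⟨hrow, hdrop⟩ := row_of_drop has
      rw [uniqueHom, Bool.cond_false_right, Bool.and_eq_true] at h
      obtain ⟨h, h'⟩ := h
      have h0 := hf.lt 0 (by simp)
      have h1 := hf.mem 0 (by simp)
      have hk : f k = k := by
        by_contra hne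
        have := allCand_spec h (f k) h0 (by simpa using h1)
        rw [zero_add, show Nat.beq (f k) k = false from
          Bool.eq_false_iff.2 fun h => hne (Nat.eq_of_beq_eq_true h), cond_false,
          ← hrow] at this
        exact noHom_spec hdrop this f hf.tail
      intro i hi
      cases i with
      | zero => exact hk
      | succ i =>
        have ht := hf.tail
        rw [hk, hrow] at ht
        have := ih hdrop h' ht i (by rw [length_prune]; simpa using hi)
        rwa [show k + (i + 1) = k + 1 + i by omega]

-- Only the 11 core vertices are mapped; `16383 = 2 ^ 14 - 1` admits all template vertices as
-- images.
set_option maxRecDepth 100000 in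
lemma uniqueHom_rows : uniqueHom rows 0 (List.replicate 11 16383) = true := by decide +kernel

/-- Adjacency of the template graph. The first `11` vertices form its core. -/
def Adj (i j : Fin 14) : Prop := bit (row i) j = true

instance : DecidableRel Adj := fun i j => inferInstanceAs (Decidable (bit (row i) j = true))

/-- The inclusion of the core. -/
abbrev core (i : Fin 11) : Fin 14 := Fin.castAdd 3 i

/-- The vertices outside the core. -/
abbrev outer (i : Fin 3) : Fin 14 := Fin.natAdd 11 i

lemma Adj.symm {i j : Fin 14} (h : Adj i j) : Adj j i := by revert i j; decide +kernel

lemma Adj.ne {i j : Fin 14} (h : Adj i j) : i ≠ j := by revert i j; decide +kernel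

/-- The inclusion is the only homomorphism of the core to the template. -/
lemma eq_core_of_hom {f : Fin 11 → Fin 14}
    (hf : ∀ i j, Adj (core i) (core j) → Adj (f i) (f j)) (i : Fin 11) : f i = core i := by
  -- The value `0` from `11` on is never examined, as there are only 11 candidate sets.
  have hfit : Fits (fun n => if h : n < 11 then f ⟨n, h⟩ else 0) 0 (List.replicate 11 16383) := by
    constructor
    · intro i hi
      simp only [zero_add]
      split_ifs <;> omega
    · intro i hi
      rw [List.length_replicate] at hi
      have : ∀ j : Fin 14, bit 16383 j = true := by decide
      simp only [zero_add, dif_pos hi]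
      rw [List.getD_replicate _ hi]
      exact this _
    · intro i j hij hj hb
      rw [List.length_replicate] at hj
      simp only [zero_add, dif_pos hj, dif_pos (hij.trans hj)] at *
      exact hf ⟨i, hij.trans hj⟩ ⟨j, hj⟩ hb
  have := uniqueHom_spec (k := 0) rfl uniqueHom_rows hfit i (by simp)
  simp only [zero_add, Fin.is_lt, dif_pos] at this
  exact Fin.ext this

/-- A vertex outside the core is determined by its neighbours in the core. -/
lemma eq_outer_of_forall_adj {k : Fin 3} {s : Fin 14}
    (h : ∀ i, Adj (core i) (outer k) → Adj (core i) s) : s = outer k := by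
  revert k s; decide +kernel

/-- This cone vertex is what makes tensions of the encoding potential differences. -/
lemma adj_zero_of_ne {s : Fin 14} (h : s ≠ 0) : Adj 0 s := by revert s; decide +kernel

lemma adj_outer {k l : Fin 3} (h : k ≠ l) : Adj (outer k) (outer l) := by
  revert k l; decide +kernel

/-- Every edge lies in a complete graph with three further vertices in the core. -/
lemma exists_core_of_adj {s t : Fin 14} (h : Adj s t) : ∃ i j k : Fin 11,
    (Adj s (core i) ∧ Adj t (core i)) ∧ (Adj s (core j) ∧ Adj t (core j) ∧ Adj (core i) (core j)) ∧
      Adj s (core k) ∧ Adj t (core k) ∧ Adj (core i) (core k) ∧ Adj (core j) (core k) := by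
  revert s t; decide +kernel

set_option synthInstance.maxHeartbeats 400000 in
set_option synthInstance.maxSize 2000 in
/-- The neighbours in the core of every vertex can be enumerated, after two adjacent ones, such that
each one is adjacent to two adjacent earlier ones. -/
lemma exists_enumeration (t : Fin 14) : ∃ p q r : Fin 11,
    (Adj t (core p) ∧ Adj t (core q) ∧ Adj (core p) (core q)) ∧
    (Adj t (core r) ∧ Adj (core p) (core r) ∧ Adj (core q) (core r)) ∧
    ∀ k, Adj t (core k) → k = p ∨ k = q ∨ ∃ i, (Adj t (core i) ∧ Adj (core i) (core k) ∧
      (i < k ∨ i = p ∨ i = q)) ∧ ∃ j, (Adj t (core j) ∧ Adj (core j) (core k) ∧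
      (j < k ∨ j = p ∨ j = q) ∧ Adj (core i) (core j)) ∧ ∃ l, Adj t (core l) ∧
      Adj (core i) (core l) ∧ Adj (core j) (core l) ∧ Adj (core k) (core l) := by
  revert t; decide +kernel

end Template

/-! ### From `TT_M` mappings to homomorphisms -/

/-- A finite simple graph as a graph in which parallel edges would be allowed. -/
def SimpleGraph.toUGraph {V : Type u} [Finite V] (G : SimpleGraph V) : UGraph.{u} where
  V := V
  E := G.edgeSet
  finite_V := inferInstance
  finite_E := inferInstance
  ends := Subtype.val
  loopless := fun e => G.not_isDiag_of_mem_edgeSet e.2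

namespace UGraph.Orientation

variable {U : UGraph.{u}} (o : U.Orientation)

lemma joins {e : U.E} {a b : U.V} (h : U.ends e = s(a, b)) : o.toDiGraph.Joins e a b := by
  have := o.ends_eq e
  rw [h, Sym2.eq_iff] at this
  exact this

lemma mem_ends_iff {e : U.E} {w : U.V} :
    w ∈ U.ends e ↔ o.toDiGraph.src e = w ∨ o.toDiGraph.tgt e = w := by
  rw [← o.ends_eq e, Sym2.mem_iff, eq_comm, eq_comm (a := w)]
  rfl

end UGraph.Orientation

/-- On a nice graph, a `TT_M` mapping for any orientations is induced by a map of the vertices. -/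
lemma DiGraph.IsTT.exists_hom {M : Type v} [Ring M] [Nontrivial M] {V W : Type u} [Finite V]
    [Finite W] [Nonempty W] {G : SimpleGraph V} {H : SimpleGraph W} (hG : G.Nice)
    {oG : G.toUGraph.Orientation} {oH : H.toUGraph.Orientation} {f : G.edgeSet → H.edgeSet}
    (hf : DiGraph.IsTT M (G := oG.toDiGraph) (H := oH.toDiGraph) f) :
    ∃ g : G →g H, f = g.mapEdgeSet := by
  classical
  have join : ∀ {a b : V} (h : G.Adj a b), oG.toDiGraph.Joins (⟨s(a, b), h⟩ : G.edgeSet) a b :=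
    fun h => oG.joins rfl
  have hmem : ∀ (e : H.edgeSet) (w : W),
      w ∈ e.1 ↔ oH.toDiGraph.src e = w ∨ oH.toDiGraph.tgt e = w :=
    fun e w => oH.mem_ends_iff (e := e)
  -- The diagonal default value on non-edges is never consulted.
  obtain ⟨φ, hφ⟩ : ∃ φ : Sym2 V → Sym2 W, ∀ e : G.edgeSet, φ e = (f e).1 :=
    ⟨Function.extend Subtype.val (fun e => (f e).1) (fun _ => s(Classical.arbitrary W,
      Classical.arbitrary W)), fun e => Subtype.val_injective.extend_apply _ _ e⟩
  have hφ' : ∀ {a b : V} (h : G.Adj a b), φ s(a, b) = (f ⟨s(a, b), h⟩).1 := fun h => hφ ⟨_, h⟩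
  have hT : G.TriangleMap φ := by
    refine ⟨fun h => ?_, fun hab hbc hac w hw => ?_, fun {a b c d} hK hcon => ?_⟩
    · rw [hφ' h]
      exact H.not_isDiag_of_mem_edgeSet (f _).2
    · rw [hφ' hab, hmem] at hw
      rw [hφ' hbc, hφ' hac, hmem, hmem]
      exact hf.mem_triangle hab.ne hbc.ne hac.ne (join hab) (join hbc) (join hac) hw
    · rw [hφ' hK.ab, hφ' hK.bc, hφ' hK.ac, hφ' hK.ad, hφ' hK.bd, hφ' hK.cd] at hcon
      simp only [SetCoe.ext_iff] at hcon
      have h1 := hK.ab.ne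
      have h2 := hK.ac.ne
      have h3 := hK.ad.ne
      have h4 := hK.bc.ne
      have h5 := hK.bd.ne
      have h6 := hK.cd.ne
      have hinj : Function.Injective ![a, b, c, d] := by
        intro i j
        fin_cases i <;> fin_cases j <;>
          simp [h1, h2, h3, h4, h5, h6, h1.symm, h2.symm, h3.symm, h4.symm, h5.symm, h6.symm]
      refine hf.not_const (x := ![a, b, c, d]) hinj (join hK.ab) (join hK.bc) (join hK.ac)
        (join hK.ad) (join hK.bd) (join hK.cd) ⟨rfl, hcon⟩
  obtain ⟨g, hg⟩ := hT.exists_map_eq hG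
  have hadj : ∀ {a b}, G.Adj a b → H.Adj (g a) (g b) := fun {a b} h => by
    have := (f ⟨s(a, b), h⟩).2
    rwa [← hφ' h, hg a b h] at this
  refine ⟨⟨g, hadj⟩, ?_⟩
  funext ⟨e, he⟩
  induction e with | _ a b
  exact Subtype.ext ((hφ' he).symm.trans (hg a b he))

/-! ### The encoding of a relation and its homomorphisms -/

/-- The vertices of the encoding of a relation on `V`: the core of the template, and three copies
of `V`. -/
abbrev EncVertex (V : Type u) : Type u := Fin 11 ⊕ V × Fin 3

namespace EncVertex

variable {V W : Type u}

/-- The vertex of the template to which a vertex of the encoding belongs. -/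
def type : EncVertex V → Fin 14
  | .inl i => Template.core i
  | .inr (_, k) => Template.outer k

/-- The condition on two vertices of the encoding that comes from the encoded relation: copies `0`
and `1` are joined according to the relation, other copies according to equality. -/
def Rel (R : V → V → Prop) : EncVertex V → EncVertex V → Prop
  | .inr (x, k), .inr (y, l) =>
    (k = 0 ∧ l = 1 → R x y) ∧ (k = 1 ∧ l = 0 → R y x) ∧ (k = 2 ∨ l = 2 → x = y)
  | _, _ => True

lemma Rel.symm {R : V → V → Prop} {p q : EncVertex V} (h : Rel R p q) : Rel R q p := by
  rcases p with i | ⟨x, k⟩ <;> rcases q with j | ⟨y, l⟩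
  · trivial
  · trivial
  · trivial
  · exact ⟨fun hk => h.2.1 hk.symm, fun hk => h.1 hk.symm, fun hk => (h.2.2 hk.symm).symm⟩

lemma rel_inl (R : V → V → Prop) (p : EncVertex V) (i : Fin 11) : Rel R p (.inl i) := by
  rcases p with j | ⟨x, k⟩ <;> trivial

/-- The map between encodings that is induced by a map. -/
def map (h : V → W) : EncVertex V → EncVertex W := Sum.map id (Prod.map h id)

lemma type_map (h : V → W) (p : EncVertex V) : type (map h p) = type p := by
  rcases p with j | ⟨x, k⟩ <;> rfl

lemma Rel.map {R : V → V → Prop} {S : W → W → Prop} {h : V → W}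
    (hR : ∀ x y, R x y → S (h x) (h y)) {p q : EncVertex V} (hpq : Rel R p q) :
    Rel S (map h p) (map h q) := by
  rcases p with i | ⟨x, k⟩ <;> rcases q with j | ⟨y, l⟩
  · trivial
  · trivial
  · trivial
  · exact ⟨fun hk => hR _ _ (hpq.1 hk), fun hk => hR _ _ (hpq.2.1 hk),
      fun hk => congrArg h (hpq.2.2 hk)⟩

lemma eq_inl_of_type {p : EncVertex V} {i : Fin 11} (h : type p = Template.core i) : p = .inl i := by
  rcases p with j | ⟨x, k⟩
  · exact congrArg _ (Fin.castAdd_injective _ _ h)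
  · have := congrArg Fin.val h
    simp [type] at this
    omega

lemma exists_eq_inr_of_type {p : EncVertex V} {k : Fin 3} (h : type p = Template.outer k) :
    ∃ x, p = .inr (x, k) := by
  rcases p with j | ⟨x, l⟩
  · have := congrArg Fin.val h
    simp [type] at this
    omega
  · exact ⟨x, by rw [Fin.natAdd_injective _ _ h]⟩

end EncVertex

open EncVertex

/-- The graph that encodes a relation. -/
def encGraph {V : Type u} (R : V → V → Prop) : SimpleGraph (EncVertex V) where
  Adj p q := Template.Adj (type p) (type q) ∧ Rel R p q
  symm := ⟨fun _ _ h => ⟨h.1.symm, h.2.symm⟩⟩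
  loopless := ⟨fun _ h => h.1.ne rfl⟩

section Encoding

variable {V W X : Type u} {R : V → V → Prop} {S : W → W → Prop}

lemma encGraph_adj_inl {p : EncVertex V} {i : Fin 11} :
    (encGraph R).Adj p (.inl i) ↔ Template.Adj (type p) (Template.core i) :=
  ⟨fun h => h.1, fun h => ⟨h, rel_inl R p i⟩⟩

lemma encGraph_adj_inl_inl {i j : Fin 11} :
    (encGraph R).Adj (.inl i) (.inl j) ↔ Template.Adj (Template.core i) (Template.core j) :=
  encGraph_adj_inl

lemma encGraph_exists_isK5 {p q : EncVertex V} (h : (encGraph R).Adj p q) :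
    ∃ i j k, (encGraph R).IsK5 p (.inl i) (.inl j) q (.inl k) := by
  obtain ⟨i, j, k, ⟨pi, qi⟩, ⟨pj, qj, ij⟩, pk, qk, ik, jk⟩ := Template.exists_core_of_adj h.1
  rw [← encGraph_adj_inl (R := R)] at pi qi pj qj pk qk
  rw [← encGraph_adj_inl_inl (R := R)] at ij ik jk
  exact ⟨i, j, k, ⟨pi, pj, h, ij, qi.symm, qj.symm⟩, pk, ik, jk, qk⟩

lemma encGraph_nice (R : V → V → Prop) : (encGraph R).Nice where
  exists_isK4 h := by
    obtain ⟨i, j, k, hK⟩ := encGraph_exists_isK5 h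
    exact ⟨_, _, hK.ad, hK.ab, hK.ac, hK.bd.symm, hK.cd.symm, hK.bc⟩
  exists_linkReach u := by
    obtain ⟨p, q, r, ⟨up, uq, pq⟩, ⟨ur, pr, qr⟩, hk⟩ := Template.exists_enumeration (type u)
    simp only [← encGraph_adj_inl (R := R), ← encGraph_adj_inl_inl (R := R)] at *
    refine ⟨.inl p, .inl q, .inl r, ⟨up, uq, ur, pq, pr, qr⟩, fun a ha => ?_⟩
    have core : ∀ k : Fin 11, (encGraph R).Adj u (.inl k) →
        (encGraph R).LinkReach u (.inl p) (.inl q) (.inl k) := by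
      intro k
      -- In the enumeration, earlier neighbours have smaller numbers or are `p` or `q`.
      induction k using WellFoundedLT.induction with | _ k ih
      intro uk
      rcases hk k uk with rfl | rfl | ⟨i, ⟨ui, ik, hi⟩, j, ⟨uj, jk, hj, ij⟩, l, ul, il, jl, kl⟩
      · exact .left
      · exact .right
      · refine .step (a := .inl i) (b := .inl j) (d := .inl l) ?_ ?_
          ⟨⟨ui, uj, uk, ij, ik, jk⟩, ul, il, jl, kl⟩
        · rcases hi with hi | rfl | rfl
          exacts [ih i hi ui, .left, .right]
        · rcases hj with hj | rfl | rfl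
          exacts [ih j hj uj, .left, .right]
    -- Any neighbour, in the core or not, is one step away from two core neighbours.
    obtain ⟨i, j, k, hK⟩ := encGraph_exists_isK5 ha
    exact .step (core i hK.ab) (core j hK.ac) hK

/-- The homomorphism of encodings that is induced by a map that respects the relations. -/
def encHom (h : V → W) (hR : ∀ x y, R x y → S (h x) (h y)) : encGraph R →g encGraph S where
  toFun := EncVertex.map h
  map_rel' hpq := ⟨by rw [type_map, type_map]; exact hpq.1, hpq.2.map hR⟩

lemma encGraph_adj_of_ne (x : V) {k : Fin 3} (hk : k ≠ 2) :
    (encGraph R).Adj (.inr (x, k)) (.inr (x, 2)) :=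
  ⟨Template.adj_outer hk, by simp, by simp, fun _ => rfl⟩

/-- All homomorphisms between encodings are induced by maps that respect the relations. -/
lemma exists_eq_encHom (g : encGraph R →g encGraph S) : ∃ h hR, g = encHom h hR := by
  -- Composed with `type`, `g` restricts to a homomorphism of the core to the template, hence to the
  -- inclusion.
  have hcore : ∀ i, type (g (.inl i)) = Template.core i :=
    Template.eq_core_of_hom fun i j hij => (g.map_adj (encGraph_adj_inl_inl.2 hij)).1
  have houter : ∀ x k, type (g (.inr (x, k))) = Template.outer k := fun x k =>
    Template.eq_outer_of_forall_adj fun i hi => by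
      have := (g.map_adj (encGraph_adj_inl.2 hi.symm : (encGraph R).Adj (.inr (x, k)) (.inl i))).1
      rw [hcore] at this
      exact this.symm
  have h1 : ∀ i, g (.inl i) = .inl i := fun i => eq_inl_of_type (hcore i)
  choose y hy using fun x k => exists_eq_inr_of_type (houter x k)
  -- The matching edges to copy 2 force the three copies of `x` to have the same image.
  have heq : ∀ x k, y x k = y x 2 := by
    intro x k
    by_cases hk : k = 2
    · rw [hk]
    · have := (g.map_adj (encGraph_adj_of_ne (R := R) x hk)).2
      rw [hy, hy] at this
      exact this.2.2 (.inr rfl)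
  refine ⟨fun x => y x 2, fun x z hxz => ?_, ?_⟩
  · have hadj : (encGraph R).Adj (.inr (x, 0)) (.inr (z, 1)) :=
      ⟨Template.adj_outer (by decide), fun _ => hxz, by simp, by simp⟩
    have := (g.map_adj hadj).2
    rw [hy, hy, heq, heq z] at this
    exact this.1 ⟨rfl, rfl⟩
  · ext p
    rcases p with i | ⟨x, k⟩
    · exact h1 i
    · rw [hy, heq]; rfl

/-- The map of edges that is induced by a map that respects the relations. -/
def encEdge (h : V → W) (hR : ∀ x y, R x y → S (h x) (h y)) :
    (encGraph R).edgeSet → (encGraph S).edgeSet := (encHom h hR).mapEdgeSet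

/-- The matching edge between copies 0 and 2 of `x` exists even for isolated `x`, and its image
reveals `h x`. -/
lemma encEdge_injective {h h' : V → W} {hR : ∀ x y, R x y → S (h x) (h y)}
    {hR' : ∀ x y, R x y → S (h' x) (h' y)} (heq : encEdge h hR = encEdge h' hR') : h = h' := by
  funext x
  have := congrArg Subtype.val
    (congrFun heq ⟨s(.inr (x, 0), .inr (x, 2)), encGraph_adj_of_ne x (by decide)⟩)
  have : s(EncVertex.map h (.inr (x, 0)), EncVertex.map h (.inr (x, 2))) =
    s(EncVertex.map h' (.inr (x, 0)), EncVertex.map h' (.inr (x, 2))) := this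
  simp [EncVertex.map] at this
  exact this

lemma encEdge_id (hR : ∀ x y, R x y → R x y) : encEdge (fun x => x) hR = id := by
  funext ⟨e, he⟩
  induction e with | _ a b
  apply Subtype.ext
  have hid : ∀ p : EncVertex V, EncVertex.map (fun x => x) p = p := by
    rintro (i | ⟨x, k⟩) <;> rfl
  exact congrArg₂ (fun p q => s(p, q)) (hid a) (hid b)

lemma encEdge_comp {T : X → X → Prop} (h : V → W) (hR : ∀ x y, R x y → S (h x) (h y))
    (h' : W → X) (hS : ∀ x y, S x y → T (h' x) (h' y))
    (hT : ∀ x y, R x y → T (h' (h x)) (h' (h y))) :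
    encEdge (fun x => h' (h x)) hT = encEdge h' hS ∘ encEdge h hR := by
  funext ⟨e, he⟩
  induction e with | _ a b
  apply Subtype.ext
  have hid : ∀ p : EncVertex V,
      EncVertex.map (fun x => h' (h x)) p = EncVertex.map h' (EncVertex.map h p) := by
    rintro (i | ⟨x, k⟩) <;> rfl
  exact congrArg₂ (fun p q => s(p, q)) (hid a) (hid b)

/-! ### Orientation and tensions of the encoding -/

lemma exists_ends_type_lt (e : (encGraph R).edgeSet) :
    ∃ p : EncVertex V × EncVertex V, s(p.1, p.2) = e.1 ∧ type p.1 < type p.2 := by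
  obtain ⟨e, he⟩ := e
  induction e with | _ a b
  have he : (encGraph R).Adj a b := he
  rcases lt_or_gt_of_ne he.1.ne with h | h
  · exact ⟨(a, b), rfl, h⟩
  · exact ⟨(b, a), Sym2.eq_swap, h⟩

variable [Finite V] [Finite W]

/-- The orientation of the encoding along the numbering of the template. -/
noncomputable def encOrientation (R : V → V → Prop) : (encGraph R).toUGraph.Orientation where
  src e := (exists_ends_type_lt e).choose.1
  tgt e := (exists_ends_type_lt e).choose.2
  ends_eq e := (exists_ends_type_lt e).choose_spec.1

lemma encOrientation_eq {e : (encGraph R).edgeSet} {a b : EncVertex V} (he : e.1 = s(a, b))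
    (hab : type a < type b) : (encOrientation R).src e = a ∧ (encOrientation R).tgt e = b := by
  have h1 := (exists_ends_type_lt e).choose_spec.1.trans he
  have h2 := (exists_ends_type_lt e).choose_spec.2
  rw [Sym2.eq_iff] at h1
  rcases h1 with h1 | h1
  · exact h1
  · rw [h1.1, h1.2] at h2
    exact absurd hab h2.asymm

/-- The encoding of a relation as a directed graph. -/
noncomputable abbrev encDiGraph (R : V → V → Prop) : DiGraph.{u} := (encOrientation R).toDiGraph

lemma encDiGraph_spec (e : (encDiGraph R).E) : ∃ a b : EncVertex V, (encDiGraph R).src e = a ∧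
    (encDiGraph R).tgt e = b ∧ e.1 = s(a, b) ∧ type a < type b :=
  ⟨_, _, rfl, rfl, (exists_ends_type_lt e).choose_spec.1.symm,
    (exists_ends_type_lt e).choose_spec.2⟩

variable {M : Type v} [Ring M]

/-- All tensions of the encoding are potential differences. -/
lemma exists_potential {τ : (encDiGraph R).E → M} (hτ : (encDiGraph R).IsTension τ) :
    ∃ p : EncVertex V → M,
      τ = fun e => p ((encDiGraph R).tgt e) - p ((encDiGraph R).src e) := by
  classical
  have hadj : ∀ q : EncVertex V, q ≠ .inl 0 → (encGraph R).Adj (.inl 0) q := fun q hq =>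
    (encGraph_adj_inl.2 (Template.adj_zero_of_ne fun h => hq (eq_inl_of_type h)).symm).symm
  obtain ⟨p, hp0, hp⟩ : ∃ p : EncVertex V → M, p (.inl 0) = 0 ∧
      ∀ (q : EncVertex V) (hq : q ≠ Sum.inl 0), p q = τ ⟨s(.inl 0, q), hadj q hq⟩ :=
    -- The potential is read off the edges at the cone vertex, which are oriented away from it
    -- because its type is least.
    ⟨fun q => if hq : q = .inl 0 then 0 else τ ⟨s(.inl 0, q), hadj q hq⟩, dif_pos rfl,
      fun q hq => dif_neg hq⟩
  refine ⟨p, ?_⟩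
  funext e
  obtain ⟨a, b, ha, hb, he, hlt⟩ := encDiGraph_spec e
  have hb0 : b ≠ .inl 0 := by
    rintro rfl
    exact absurd hlt (Fin.not_lt_zero _)
  rw [ha, hb, hp b hb0]
  by_cases ha0 : a = .inl 0
  · rw [ha0, hp0, sub_zero]
    exact congrArg τ (Subtype.ext (by rw [he, ha0]))
  · rw [hp a ha0]
    have hpos : ∀ {q : EncVertex V}, q ≠ .inl 0 → type (.inl 0 : EncVertex V) < type q :=
      fun hq => Fin.pos_of_ne_zero fun h => hq (eq_inl_of_type h)
    have h1 := encOrientation_eq (R := R) (e := ⟨s(.inl 0, a), hadj a ha0⟩) rfl (hpos ha0)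
    have h2 := encOrientation_eq (R := R) (e := ⟨s(.inl 0, b), hadj b hb0⟩) rfl (hpos hb0)
    have hab : a ≠ b := fun h => by rw [h] at hlt; exact lt_irrefl _ hlt
    have := hτ.triangle (x := .inl 0) (y := a) (z := b) (Ne.symm ha0) hab (Ne.symm hb0)
      (.inl h1) (.inl ⟨ha, hb⟩) (.inl h2)
    have s1 : (encDiGraph R).sign ⟨s(.inl 0, a), hadj a ha0⟩ (.inl 0) = 1 := if_pos h1.1
    have s2 : (encDiGraph R).sign ⟨s(.inl 0, b), hadj b hb0⟩ (.inl 0) = 1 := if_pos h2.1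
    have s3 : (encDiGraph R).sign e a = 1 := if_pos ha
    rw [s1, s2, s3, one_smul, one_smul, one_smul] at this
    rw [← this, add_sub_cancel_left]

/-- The vertex map preserves types and therefore orientations, so the difference of a potential `p`
pulls back to that of `p ∘ EncVertex.map h`. -/
lemma isTT_encEdge (M : Type v) [Ring M] (h : V → W) (hR : ∀ x y, R x y → S (h x) (h y)) :
    DiGraph.IsTT M (G := encDiGraph R) (H := encDiGraph S) (encEdge h hR) := by
  intro τ hτ
  obtain ⟨p, rfl⟩ := exists_potential hτ
  convert (encDiGraph R).isTension_potential fun q => p (EncVertex.map h q) using 1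
  funext e
  obtain ⟨a, b, ha, hb, he, hlt⟩ := encDiGraph_spec e
  have := encOrientation_eq (R := S) (e := encEdge h hR e) (a := EncVertex.map h a)
    (b := EncVertex.map h b) (show Sym2.map _ e.1 = _ by rw [he]; rfl)
    (by rw [type_map, type_map]; exact hlt)
  rw [ha, hb]
  exact congrArg₂ (fun q q' => p q - p q') this.2 this.1

/-- Arbitrary orientations are allowed because an undirected `TT_M` mapping comes with unknown ones.
-/
lemma exists_encEdge_eq [Nontrivial M] {o : (encGraph R).toUGraph.Orientation}
    {o' : (encGraph S).toUGraph.Orientation} {f : (encGraph R).edgeSet → (encGraph S).edgeSet}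
    (hf : DiGraph.IsTT M (G := o.toDiGraph) (H := o'.toDiGraph) f) :
    ∃ h, ∃ hR : ∀ x y, R x y → S (h x) (h y), encEdge h hR = f := by
  obtain ⟨g, rfl⟩ := hf.exists_hom (encGraph_nice R)
  obtain ⟨h, hR, rfl⟩ := exists_eq_encHom g
  exact ⟨h, hR, rfl⟩

end Encoding

/-! ### The two functors -/

/-- Adjacency in a directed graph. -/
def DiGraph.Adj (G : DiGraph.{u}) (x y : G.V) : Prop := ∃ e, G.src e = x ∧ G.tgt e = y

lemma DiGraph.Hom.map_adj {G H : DiGraph.{u}} (f : G.Hom H) (x y : G.V) (h : G.Adj x y) :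
    H.Adj (f.toFun x) (f.toFun y) := by
  obtain ⟨e, rfl, rfl⟩ := h
  exact f.map_edge e

/-- Adjacency in an undirected graph. -/
def UGraph.Adj (G : UGraph.{u}) (x y : G.V) : Prop := ∃ e, G.ends e = s(x, y)

lemma UGraph.Hom.map_adj {G H : UGraph.{u}} (f : G.Hom H) (x y : G.V) (h : G.Adj x y) :
    H.Adj (f.toFun x) (f.toFun y) := by
  obtain ⟨e, he⟩ := h
  obtain ⟨e', he'⟩ := f.map_edge e
  exact ⟨e', by rw [he', he]; rfl⟩

lemma UGraph.exists_hom {G H : UGraph.{u}} {h : G.V → H.V}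
    (hh : ∀ x y, G.Adj x y → H.Adj (h x) (h y)) : ∃ f : G.Hom H, f.toFun = h := by
  refine ⟨⟨h, fun e => ?_⟩, rfl⟩
  obtain ⟨⟨x, y⟩, hxy⟩ := (Quot.exists_rep (G.ends e))
  obtain ⟨e', he'⟩ := hh x y ⟨e, hxy.symm⟩
  exact ⟨e', by rw [he', ← hxy]; rfl⟩

/-- The encoding of a directed graph. -/
noncomputable def DiGraph.enc (G : DiGraph.{u}) : DiGraph.{u} :=
  haveI := G.finite_V
  encDiGraph G.Adj

/-- The encoding of an undirected graph. -/
def UGraph.enc (G : UGraph.{u}) : UGraph.{u} :=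
  haveI := G.finite_V
  (encGraph G.Adj).toUGraph

/-- The map between encodings that is induced by a homomorphism of directed graphs. -/
def DiGraph.Hom.enc {G H : DiGraph.{u}} (f : G.Hom H) : G.enc.E → H.enc.E :=
  encEdge f.toFun f.map_adj

/-- The map between encodings that is induced by a homomorphism of undirected graphs. -/
def UGraph.Hom.enc {G H : UGraph.{u}} (f : G.Hom H) : G.enc.E → H.enc.E :=
  encEdge f.toFun f.map_adj

lemma DiGraph.bijOn_enc (M : Type v) [Ring M] [Nontrivial M] (G H : DiGraph.{u}) :
    Set.BijOn (fun f : G.Hom H => f.enc) Set.univ {h | IsTT M h} := by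
  have := G.finite_V
  have := H.finite_V
  refine ⟨fun f _ => isTT_encEdge M f.toFun f.map_adj,
    fun f _ g _ h => Hom.ext (encEdge_injective h), fun φ hφ => ?_⟩
  obtain ⟨h, hR, rfl⟩ := exists_encEdge_eq (R := G.Adj) (S := H.Adj) hφ
  exact ⟨⟨h, fun e => hR _ _ ⟨e, rfl, rfl⟩⟩, trivial, rfl⟩

lemma UGraph.bijOn_enc (M : Type v) [Ring M] [Nontrivial M] (G H : UGraph.{u}) :
    Set.BijOn (fun f : G.Hom H => f.enc) Set.univ {h | IsTT M h} := by
  have := G.finite_V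
  have := H.finite_V
  refine ⟨fun f _ => ⟨encOrientation G.Adj, encOrientation H.Adj,
    isTT_encEdge M f.toFun f.map_adj⟩, fun f _ g _ h => Hom.ext (encEdge_injective h), ?_⟩
  rintro φ ⟨o, o', hφ⟩
  obtain ⟨h, hR, rfl⟩ := exists_encEdge_eq (R := G.Adj) (S := H.Adj) (o := o) (o' := o') hφ
  obtain ⟨f, rfl⟩ := UGraph.exists_hom hR
  exact ⟨f, trivial, rfl⟩

lemma Set.BijOn.nonempty_iff_exists {α β : Type*} {f : α → β} {p : β → Prop}
    (h : Set.BijOn f Set.univ {b | p b}) : Nonempty α ↔ ∃ b, p b :=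
  ⟨fun ⟨a⟩ => ⟨f a, h.mapsTo trivial⟩, fun ⟨_, hb⟩ => let ⟨a, _, _⟩ := h.surjOn hb; ⟨a⟩⟩

theorem theorem4p6 :
    -- directed graphs
    (∃ (F : DiGraph.{u} → DiGraph.{u})
        (Fmap : ∀ G H : DiGraph.{u}, DiGraph.Hom G H → (F G).E → (F H).E),
      -- `F` is a functor
      (∀ G, Fmap G G (DiGraph.Hom.id G) = id) ∧
      (∀ G H K (f : DiGraph.Hom G H) (g : DiGraph.Hom H K),
        Fmap G K (g.comp f) = Fmap H K g ∘ Fmap G H f) ∧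
      ∀ (M : Type v) [Ring M] [Nontrivial M],
        (∀ G H, DiGraph.HomLE G H ↔ DiGraph.TTLE M (F G) (F H)) ∧
        -- `f ↦ F(f)` is a bijection from homomorphisms `G → H` to `TT_M` maps `F(G) → F(H)`
        (∀ G H, Set.BijOn (Fmap G H) Set.univ {h | DiGraph.IsTT M h})) ∧
    -- undirected graphs
    (∃ (F : UGraph.{u} → UGraph.{u})
        (Fmap : ∀ G H : UGraph.{u}, UGraph.Hom G H → (F G).E → (F H).E),
      (∀ G, Fmap G G (UGraph.Hom.id G) = id) ∧
      (∀ G H K (f : UGraph.Hom G H) (g : UGraph.Hom H K),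
        Fmap G K (g.comp f) = Fmap H K g ∘ Fmap G H f) ∧
      ∀ (M : Type v) [Ring M] [Nontrivial M],
        (∀ G H, UGraph.HomLE G H ↔ UGraph.TTLE M (F G) (F H)) ∧
        (∀ G H, Set.BijOn (Fmap G H) Set.univ {h | UGraph.IsTT M h})) := by
  refine ⟨⟨DiGraph.enc, fun _ _ f => f.enc, fun G => encEdge_id _, fun G H K f g => ?_,
    fun M _ _ => ⟨fun G H => (DiGraph.bijOn_enc M G H).nonempty_iff_exists,
      DiGraph.bijOn_enc M⟩⟩,
    ⟨UGraph.enc, fun _ _ f => f.enc, fun G => encEdge_id _, fun G H K f g => ?_,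
    fun M _ _ => ⟨fun G H => (UGraph.bijOn_enc M G H).nonempty_iff_exists, UGraph.bijOn_enc M⟩⟩⟩
  · exact encEdge_comp f.toFun f.map_adj g.toFun g.map_adj _
  · exact encEdge_comp f.toFun f.map_adj g.toFun g.map_adj _
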